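/- For $k\ge 1$ let $\mathbf C_k$ be the $k$-element Heyting chain $0<1<\dots<k-1$, where $a\to b=\top$ if $a\le b$ and $a\to b=b$ otherwise, and let $\mathcal G_k=\mathbb{ISP}(\mathbf C_k)$ be the variety (equivalently, quasivariety) of Heyting algebras generated by $\mathbf C_k$. Let $\mathbf M$ be a finite algebra. A total (single-sorted) alter ego of $\mathbf M$ is a topological structure $\mathbb M=(M;G,R,\mathcal T)$, where $G$ is a set of finitary total operations that are homomorphisms $\mathbf M^k\to\mathbf M$, $R$ is a set of finitary relations that are subuniverses of powers $\mathbf M^k$, and $\mathcal T$ is the discrete topology (no partial operations occur). Let $\mathcal X$ be the class of isomorphic copies of closed substructures (possibly empty) of nonzero powers of $\mathbb M$, with the continuous structure-preserving maps as morphisms. For $\mathbf A\in\mathbb{ISP}(\mathbf M)$ let $D(\mathbf A)=\mathrm{Hom}(\mathbf A,\mathbf M)\le\mathbb M^A$, and for $\mathbf X\in\mathcal X$ let $E(\mathbf X)=\mathcal X(\mathbf X,\mathbb M)\le\mathbf M^X$. The alter ego $\mathbb M$ yields a duality on $\mathbb{ISP}(\mathbf M)$ if for every $\mathbf A\in\mathbb{ISP}(\mathbf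 M)$ the evaluation map $e_{\mathbf A}\colon\mathbf A\to ED(\mathbf A)$, $e_{\mathbf A}(a)(x)=x(a)$, is an isomorphism; the duality is full if moreover $DE(\mathbf X)\cong\mathbf X$ for all $\mathbf X\in\mathcal X$. The alter ego yields a strong duality if it yields a duality and every closed substructure $X$ of every nonzero power $\mathbb M^S$ is term-closed, i.e. for each $y\in M^S\setminus X$ there are $S$-ary term functions $\sigma,\tau\colon M^S\to M$ of $\mathbf M$ with $\sigma|_X=\tau|_X$ and $\sigma(y)\ne\tau(y)$; another standard definition, equivalent to this one, is that $\mathbb M$ yields a full duality and is injective in $\mathcal X$ with respect to embeddings. Corollary. Let $n\ge 4$. The variety $\mathcal G_n$ admits no total single-sorted strong duality: if $\mathbf M$ is any finite algebra with $\mathbb{ISP}(\mathbf M)=\mathcal G_n$ (for instance $\mathbf M=\mathbf C_n$), then no total alter ego of $\mathbf M$ yields a strong duality on $\mathcal G_n$, in either of the two senses above. -/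

import Mathlib

universe u v

/-! ## Gödel chains and the classes `ISP(M)` -/

/-- The `n`-element Heyting chain `Cₙ`, with elements `0 < 1 < ⋯ < n - 1`. -/
abbrev GodelChain (n : ℕ) : Type := Fin n

/-- The implication of `Cₙ`. -/
theorem GodelChain.himp_eq (n : ℕ) [NeZero n] (a b : GodelChain n) :
    a ⇨ b = if a ≤ b then ⊤ else b := by
  split_ifs with h
  · exact himp_eq_top_iff.mpr h
  · refine le_antisymm ?_ le_himp
    have h1 : (a ⇨ b) ⊓ a ≤ b := himp_inf_le
    rcases inf_le_iff.mp h1 with h2 | h2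
    · exact h2
    · exact absurd h2 h

/-- `A` belongs to `ISP(M)`: it embeds, as a Heyting algebra, into a power of `M`. -/
def InISP (A : Type u) [HeytingAlgebra A] (M : Type v) [HeytingAlgebra M] : Prop :=
  ∃ (S : Type u) (f : HeytingHom A (S → M)), Function.Injective f

/-- `A` belongs to the variety `𝒢ₙ = ISP(Cₙ)`. -/
def InGodelVariety (n : ℕ) [NeZero n] (A : Type u) [HeytingAlgebra A] : Prop :=
  InISP A (GodelChain n)

/-- Subuniverses of a Heyting algebra. -/
structure IsHeytingSubuniverse {A : Type u} [HeytingAlgebra A] (r : Set A) : Prop where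
  bot_mem : ⊥ ∈ r
  top_mem : ⊤ ∈ r
  inf_mem : ∀ a ∈ r, ∀ b ∈ r, a ⊓ b ∈ r
  sup_mem : ∀ a ∈ r, ∀ b ∈ r, a ⊔ b ∈ r
  himp_mem : ∀ a ∈ r, ∀ b ∈ r, a ⇨ b ∈ r

/-- The homomorphism `a ↦ (v₁ a, …, vₖ a)` into a finite power. -/
def HeytingHom.tuple {A : Type u} {M : Type v} [HeytingAlgebra A] [HeytingAlgebra M] {k : ℕ}
    (w : Fin k → HeytingHom A M) : HeytingHom A (Fin k → M) where
  toFun a := fun i => w i a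
  map_sup' a b := by funext i; simp
  map_inf' a b := by funext i; simp
  map_bot' := by funext i; simp
  map_himp' a b := by funext i; simp

/-! ## Total alter egos and their topological structures

Throughout, the finite algebra `M` carries the discrete topology. -/

/-- A total (single-sorted) alter ego `(M; G, R, 𝒯)` of the algebra `M`: a set `G` of finitary
total operations on `M` which are homomorphisms `Mᵏ → M`, and a set `R` of finitary relations on
`M` which are subuniverses of `Mᵏ`. There are no (non-total) partial operations. -/
structure TotalAlterEgo (M : Type u) [HeytingAlgebra M] where
  ops : ∀ k : ℕ, Set (HeytingHom (Fin k → M) M)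
  rels : ∀ k : ℕ, Set (Set (Fin k → M))
  rels_algebraic : ∀ k, ∀ r ∈ rels k, IsHeytingSubuniverse r

namespace TotalAlterEgo

section

variable {M : Type u} [HeytingAlgebra M] (𝕄 : TotalAlterEgo M)

/-- Topological structures of the same type as the alter ego `𝕄`. -/
structure Str where
  carrier : Type u
  [top : TopologicalSpace carrier]
  op : ∀ k : ℕ, 𝕄.ops k → (Fin k → carrier) → carrier
  rel : ∀ k : ℕ, 𝕄.rels k → Set (Fin k → carrier)

attribute [instance] Str.top

variable {𝕄}

/-- Morphisms: continuous structure-preserving maps. -/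
@[ext]
structure Hom (X Y : 𝕄.Str) where
  toFun : X.carrier → Y.carrier
  continuous_toFun : Continuous toFun
  map_op : ∀ k (g : 𝕄.ops k) (w : Fin k → X.carrier),
    toFun (X.op k g w) = Y.op k g (fun i => toFun (w i))
  map_rel : ∀ k (r : 𝕄.rels k) (w : Fin k → X.carrier),
    w ∈ X.rel k r → (fun i => toFun (w i)) ∈ Y.rel k r

/-- Embeddings: isomorphisms onto a substructure of the codomain. -/
structure Hom.IsEmbedding {X Y : 𝕄.Str} (φ : Hom X Y) : Prop where
  isEmbedding_toFun : Topology.IsEmbedding φ.toFun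
  reflects_rel : ∀ k (r : 𝕄.rels k) (w : Fin k → X.carrier),
    (fun i => φ.toFun (w i)) ∈ Y.rel k r → w ∈ X.rel k r

/-- `X` and `Y` are isomorphic: there are mutually inverse morphisms between them. -/
def Isomorphic (X Y : 𝕄.Str) : Prop :=
  ∃ (φ : Hom X Y) (ψ : Hom Y X),
    (∀ x, ψ.toFun (φ.toFun x) = x) ∧ ∀ y, φ.toFun (ψ.toFun y) = y

variable [TopologicalSpace M] (𝕄)

/-- The alter ego as a topological structure. -/
def self : 𝕄.Str where
  carrier := M
  op _ g w := g.1 w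
  rel _ r := r.1

/-- The power `𝕄^S`, with product topology and pointwise operations and relations. -/
def power (S : Type u) : 𝕄.Str where
  carrier := S → M
  op _ g w := fun s => g.1 (fun i => w i s)
  rel _ r := {w | ∀ s, (fun i => w i s) ∈ r.1}

variable {𝕄}

/-- `X` is isomorphic to a topologically closed substructure of a nonzero power of `𝕄`,
i.e. it belongs to the topological quasivariety generated by `𝕄`. The empty structure is
included. -/
def InTopQuasivariety (X : 𝕄.Str) : Prop :=
  ∃ (S : Type u) (_ : Nonempty S) (φ : Hom X (𝕄.power S)),
    φ.IsEmbedding ∧ IsClosed (Set.range φ.toFun)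

variable (𝕄)

/-! ## The hom-functors on objects and the evaluation maps -/

/-- The dual `D(A)` of an algebra `A`: the set of homomorphisms `A → M` as a substructure of the
power `𝕄^A`. -/
def D (A : Type u) [HeytingAlgebra A] : 𝕄.Str where
  carrier := HeytingHom A M
  top := TopologicalSpace.induced (fun x => (x : A → M)) inferInstance
  op _ g w := g.1.comp (HeytingHom.tuple w)
  rel _ r := {w | ∀ a, (fun i => w i a) ∈ r.1}

end

section

variable {M : Type u} [HeytingAlgebra M] [TopologicalSpace M] {𝕄 : TotalAlterEgo M}

/-- The underlying set of the algebra `E(X)`: the set of morphisms `X → 𝕄`. -/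
def E (X : 𝕄.Str) : Type u := Hom X 𝕄.self

namespace E

variable {X : 𝕄.Str}

/-- The map underlying an element of `E(X)`. -/
def toMap (f : E X) : X.carrier → M := Hom.toFun f

theorem toMap_injective : Function.Injective (toMap (X := X)) := by
  intro f g h
  exact Hom.ext h

theorem continuous_toMap (f : E X) : Continuous f.toMap := Hom.continuous_toFun f

theorem toMap_op (f : E X) {k : ℕ} (g : 𝕄.ops k) (w : Fin k → X.carrier) :
    f.toMap (X.op k g w) = g.1 (fun i => f.toMap (w i)) := Hom.map_op f k g w

theorem toMap_rel (f : E X) {k : ℕ} (r : 𝕄.rels k) (w : Fin k → X.carrier)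
    (hw : w ∈ X.rel k r) : (fun i => f.toMap (w i)) ∈ r.1 := Hom.map_rel f k r w hw

variable [DiscreteTopology M]

/-- Morphisms `X → 𝕄` are closed under a binary operation of `M`, applied pointwise, which
commutes with the operations and preserves the relations of `𝕄`. -/
def map₂ (b : M → M → M)
    (hop : ∀ k (g : 𝕄.ops k) (w z : Fin k → M),
      g.1 (fun i => b (w i) (z i)) = b (g.1 w) (g.1 z))
    (hrel : ∀ k (r : 𝕄.rels k), ∀ w ∈ r.1, ∀ z ∈ r.1, (fun i => b (w i) (z i)) ∈ r.1)
    (f g : E X) : E X where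
  toFun x := b (f.toMap x) (g.toMap x)
  continuous_toFun :=
    (continuous_of_discreteTopology (f := fun p : M × M => b p.1 p.2)).comp
      (f.continuous_toMap.prodMk g.continuous_toMap)
  map_op k h w := by
    change b _ _ = h.1 (fun i => b (f.toMap (w i)) (g.toMap (w i)))
    rw [hop, toMap_op, toMap_op]
  map_rel k r w hw := hrel k r _ (f.toMap_rel r w hw) _ (g.toMap_rel r w hw)

instance : Max (E X) := ⟨map₂ (· ⊔ ·) (fun _ g w z => map_sup g.1 w z)
  (fun k r w hw z hz => (𝕄.rels_algebraic k r.1 r.2).sup_mem w hw z hz)⟩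

instance : Min (E X) := ⟨map₂ (· ⊓ ·) (fun _ g w z => map_inf g.1 w z)
  (fun k r w hw z hz => (𝕄.rels_algebraic k r.1 r.2).inf_mem w hw z hz)⟩

instance : HImp (E X) := ⟨map₂ (· ⇨ ·) (fun _ g w z => map_himp g.1 w z)
  (fun k r w hw z hz => (𝕄.rels_algebraic k r.1 r.2).himp_mem w hw z hz)⟩

instance : Bot (E X) := ⟨{
  toFun := fun _ => (⊥ : M)
  continuous_toFun := continuous_const
  map_op := fun _ g _ => (map_bot g.1).symm
  map_rel := fun k r _ _ => (𝕄.rels_algebraic k r.1 r.2).bot_mem }⟩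

instance : Top (E X) := ⟨{
  toFun := fun _ => (⊤ : M)
  continuous_toFun := continuous_const
  map_op := fun _ g _ => (map_top g.1).symm
  map_rel := fun k r _ _ => (𝕄.rels_algebraic k r.1 r.2).top_mem }⟩

instance : Compl (E X) := ⟨fun f => f ⇨ ⊥⟩

instance : LE (E X) := ⟨fun f g => f.toMap ≤ g.toMap⟩

instance : LT (E X) := ⟨fun f g => f.toMap < g.toMap⟩

/-- `E(X)` is a Heyting algebra under the pointwise operations. -/
instance : HeytingAlgebra (E X) :=
  toMap_injective.heytingAlgebra (toMap (X := X)) Iff.rfl Iff.rfl (fun _ _ => rfl)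
    (fun _ _ => rfl) rfl rfl (fun f => himp_bot f.toMap) (fun _ _ => rfl)

end E

variable [DiscreteTopology M] (𝕄)

/-- The evaluation map `e_A : A → ED(A)`, `e_A(a)(x) = x(a)`. -/
def eval (A : Type u) [HeytingAlgebra A] : HeytingHom A (E (𝕄.D A)) where
  toFun a :=
    { toFun := fun x : HeytingHom A M => x a
      continuous_toFun := (continuous_apply a).comp continuous_induced_dom
      map_op := fun _ _ _ => rfl
      map_rel := fun _ _ _ hw => hw a }
  map_sup' a b := E.toMap_injective (funext fun x : HeytingHom A M => map_sup x a b)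
  map_inf' a b := E.toMap_injective (funext fun x : HeytingHom A M => map_inf x a b)
  map_bot' := E.toMap_injective (funext fun x : HeytingHom A M => map_bot x)
  map_himp' a b := E.toMap_injective (funext fun x : HeytingHom A M => map_himp x a b)

/-! ## Dualities, full dualities, strong dualities -/

/-- `𝕄` yields a duality on `ISP(M)`: each evaluation map `e_A : A → ED(A)` is an isomorphism. -/
def YieldsDuality : Prop :=
  ∀ (A : Type u) [HeytingAlgebra A], InISP A M → Function.Bijective (𝕄.eval A)

/-- `𝕄` yields a full duality on `ISP(M)`: it yields a duality and `DE(X) ≅ X` for every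
structure `X` in the topological quasivariety generated by `𝕄`. -/
def YieldsFullDuality : Prop :=
  𝕄.YieldsDuality ∧ ∀ X : 𝕄.Str, InTopQuasivariety X → Isomorphic (𝕄.D (E X)) X

/-- `𝕄` is injective, with respect to embeddings, in the topological quasivariety it generates. -/
def IsInjective : Prop :=
  ∀ X Y : 𝕄.Str, InTopQuasivariety X → InTopQuasivariety Y →
    ∀ φ : Hom X Y, φ.IsEmbedding → ∀ α : Hom X 𝕄.self,
      ∃ β : Hom Y 𝕄.self, ∀ x, β.toFun (φ.toFun x) = α.toFun x

/-- A set of points of the power `𝕄^S` is the universe of a closed substructure. -/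
structure IsClosedSubstructure (S : Type u) (X : Set (S → M)) : Prop where
  isClosed : IsClosed X
  op_mem : ∀ k (g : 𝕄.ops k) (w : Fin k → S → M), (∀ i, w i ∈ X) →
    (fun s => g.1 (fun i => w i s)) ∈ X

end

end TotalAlterEgo

/-- The `S`-ary term functions `M^S → M` of the Heyting algebra `M`. -/
inductive IsTermFunction {M : Type u} [HeytingAlgebra M] {S : Type u} : ((S → M) → M) → Prop
  | proj (s : S) : IsTermFunction (fun y => y s)
  | bot : IsTermFunction (fun _ => ⊥)
  | top : IsTermFunction (fun _ => ⊤)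
  | inf {σ τ : (S → M) → M} : IsTermFunction σ → IsTermFunction τ →
      IsTermFunction (fun y => σ y ⊓ τ y)
  | sup {σ τ : (S → M) → M} : IsTermFunction σ → IsTermFunction τ →
      IsTermFunction (fun y => σ y ⊔ τ y)
  | himp {σ τ : (S → M) → M} : IsTermFunction σ → IsTermFunction τ →
      IsTermFunction (fun y => σ y ⇨ τ y)

/-- `X ⊆ M^S` is term-closed: each point outside `X` is separated from `X` by a pair of `S`-ary
term functions which agree on `X`. -/
def IsTermClosed {M : Type u} [HeytingAlgebra M] {S : Type u} (X : Set (S → M)) : Prop :=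
  ∀ y, y ∉ X → ∃ σ τ : (S → M) → M,
    IsTermFunction σ ∧ IsTermFunction τ ∧ (∀ x ∈ X, σ x = τ x) ∧ σ y ≠ τ y

/-- `𝕄` yields a strong duality on `ISP(M)`: it yields a duality and every closed substructure of
a nonzero power of `𝕄` is term-closed. -/
def TotalAlterEgo.YieldsStrongDuality {M : Type u} [HeytingAlgebra M] [TopologicalSpace M]
    [DiscreteTopology M] (𝕄 : TotalAlterEgo M) : Prop :=
  𝕄.YieldsDuality ∧
    ∀ (S : Type u), Nonempty S → ∀ X : Set (S → M), 𝕄.IsClosedSubstructure S X → IsTermClosed X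

/-!
The operations of a total alter ego act pointwise on homomorphisms, so for every homomorphism
`ι : A → B` the homomorphisms `A → M` which extend along `ι` form a substructure of a power of `𝕄`.
If `ι` is injective and `B ∈ ISP(M)`, then terms cannot separate this substructure from any other
homomorphism `A → M`. Hence term-closedness forces every homomorphism into `M` to extend along `ι`,
and this property passes from `M` to its retract `Cₙ`. But for `n ≥ 4` let `ι` and `κ` be the
embeddings of `Cₙ₋₁` into `Cₙ` which omit the elements `1` and `2`. The coatom is in the range of
`ι`, so an endomorphism `f` of `Cₙ` with `f ∘ ι = κ` does not send it to `⊤`. Then `f` is injective,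
hence it is the identity, although `ι ≠ κ`.

A full duality with an injective alter ego gives term-closedness: morphisms into `𝕄` from a closed
`X ⊆ 𝕄^S` are restrictions of term functions, so a point which terms cannot separate from `X`
defines a homomorphism `E(X) → M`, and by fullness such a homomorphism is evaluation at a point
of `X`.
-/

/-! ## Homomorphisms of Heyting algebras -/

/-- The projection of a power of `M` to one of its coordinates, as a homomorphism. -/
def coordHom {S : Type u} (M : Type v) [HeytingAlgebra M] (s : S) : HeytingHom (S → M) M where
  toFun x := x s
  map_sup' _ _ := rfl
  map_inf' _ _ := rfl
  map_bot' := rfl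
  map_himp' _ _ := rfl

/-- The diagonal embedding of `M` into a power, as a homomorphism. -/
def constHom (S : Type u) (M : Type v) [HeytingAlgebra M] : HeytingHom M (S → M) where
  toFun := Function.const S
  map_sup' _ _ := rfl
  map_inf' _ _ := rfl
  map_bot' := rfl
  map_himp' _ _ := rfl

theorem InISP.exists_hom_ne {A : Type u} {M : Type v} [HeytingAlgebra A] [HeytingAlgebra M]
    (hA : InISP A M) {a b : A} (hab : a ≠ b) : ∃ f : HeytingHom A M, f a ≠ f b := by
  obtain ⟨S, f, hf⟩ := hA
  obtain ⟨s, hs⟩ := Function.ne_iff.mp (hf.ne hab)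
  exact ⟨(coordHom M s).comp f, hs⟩

theorem InISP.of_injective {A : Type u} {M : Type v} [HeytingAlgebra A] [HeytingAlgebra M]
    (f : HeytingHom A M) (hf : Function.Injective f) : InISP A M :=
  ⟨PUnit, (constHom PUnit M).comp f, Function.const_injective.comp hf⟩

theorem injective_of_map_coatom_ne_top {A B : Type*} [HeytingAlgebra A] [HeytingAlgebra B] {c : A}
    (hc : ∀ a, a ≠ ⊤ → a ≤ c) {f : HeytingHom A B} (hf : f c ≠ ⊤) : Function.Injective f := by
  have le_of_map_eq {a b : A} (h : f a = f b) : a ≤ b := by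
    by_contra hab
    have hfab : f (a ⇨ b) = ⊤ := by rw [map_himp, h, himp_self]
    have habc : a ⇨ b ≤ c := hc _ (mt himp_eq_top_iff.mp hab)
    exact hf (top_le_iff.mp (hfab ▸ OrderHomClass.mono f habc))
  exact fun a b h => le_antisymm (le_of_map_eq h) (le_of_map_eq h.symm)

namespace GodelChain

variable {m n : ℕ}

theorem le_coatom (a : GodelChain (n + 2)) (ha : a ≠ ⊤) : a ≤ (Fin.last n).castSucc :=
  Fin.le_castSucc_iff.mpr (lt_top_iff_ne_top.mpr ha)

theorem coatom_ne_top : (Fin.last n).castSucc ≠ (⊤ : GodelChain (n + 2)) :=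
  (Fin.castSucc_lt_last _).ne

theorem eq_id_of_injective [NeZero n] {f : HeytingHom (GodelChain n) (GodelChain n)}
    (hf : Function.Injective f) : f = HeytingHom.id _ := by
  have hmono : StrictMono f := (OrderHomClass.mono f).strictMono_of_injective hf
  exact HeytingHom.ext fun a => le_antisymm hmono.apply_le hmono.le_apply

/-- A strictly monotone map between Gödel chains which preserves the bounds, as a homomorphism. -/
def homOfStrictMono [NeZero m] [NeZero n] (f : GodelChain m → GodelChain n) (hf : StrictMono f)
    (hbot : f ⊥ = ⊥) (htop : f ⊤ = ⊤) : HeytingHom (GodelChain m) (GodelChain n) where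
  toFun := f
  map_sup' _ _ := hf.monotone.map_max
  map_inf' _ _ := hf.monotone.map_min
  map_bot' := hbot
  map_himp' a b := by
    rw [himp_eq, himp_eq, apply_ite f, htop]
    simp only [hf.le_iff_le]

/-- The embedding of `Cₙ₊₂` into `Cₙ₊₃` which omits the element `i`, different from the bounds. -/
def succAboveHom (i : Fin (n + 3)) (hbot : 0 < i) (htop : i < Fin.last (n + 2)) :
    HeytingHom (GodelChain (n + 2)) (GodelChain (n + 3)) :=
  homOfStrictMono i.succAbove (Fin.strictMono_succAbove i)
    (Fin.succAbove_ne_zero_zero hbot.ne') (Fin.succAbove_ne_last_last htop.ne)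

theorem succAboveHom_injective (i : Fin (n + 3)) (hbot : 0 < i) (htop : i < Fin.last (n + 2)) :
    Function.Injective (succAboveHom i hbot htop) :=
  Fin.succAbove_right_injective

theorem comp_succAboveHom_ne {i j : Fin (n + 3)} (hi : 0 < i) (hij : i < j)
    (hj : j < Fin.last (n + 2)) (f : HeytingHom (GodelChain (n + 3)) (GodelChain (n + 3))) :
    f.comp (succAboveHom i hi (hij.trans hj)) ≠ succAboveHom j (hi.trans hij) hj := by
  intro h
  have hcoatom : succAboveHom i hi (hij.trans hj) (Fin.last n).castSucc =
      (Fin.last (n + 1)).castSucc := by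
    refine Fin.succAbove_of_le_castSucc _ _ ?_
    simp only [Fin.lt_def, Fin.le_def, Fin.val_castSucc, Fin.val_last] at hij hj ⊢
    lia
  have hf_coatom : f (Fin.last (n + 1)).castSucc ≠ ⊤ := by
    rw [← hcoatom, ← HeytingHom.comp_apply, h, ← map_top (succAboveHom j (hi.trans hij) hj)]
    exact (succAboveHom_injective _ _ _).ne coatom_ne_top
  have hf : f = HeytingHom.id _ :=
    eq_id_of_injective (injective_of_map_coatom_ne_top le_coatom hf_coatom)
  rw [hf, HeytingHom.id_comp] at h
  exact hij.ne (Fin.succAbove_left_injective (congrArg DFunLike.coe h))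

theorem exists_embedding_comp_ne (n : ℕ) :
    ∃ ι κ : HeytingHom (GodelChain (n + 3)) (GodelChain (n + 4)),
      Function.Injective ι ∧ ∀ f : HeytingHom _ _, f.comp ι ≠ κ := by
  let i : Fin (n + 4) := ⟨1, by lia⟩
  let j : Fin (n + 4) := ⟨2, by lia⟩
  have hi : 0 < i := Fin.mk_lt_mk.mpr one_pos
  have hij : i < j := Fin.mk_lt_mk.mpr one_lt_two
  have hj : j < Fin.last (n + 3) := Fin.mk_lt_mk.mpr (by lia)
  exact ⟨succAboveHom i hi (hij.trans hj), succAboveHom j (hi.trans hij) hj,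
    succAboveHom_injective _ _ _, comp_succAboveHom_ne hi hij hj⟩

theorem exists_retraction {M : Type u} [HeytingAlgebra M]
    (hM : ∀ (A : Type u) [HeytingAlgebra A], InISP A M ↔ InGodelVariety (n + 2) A) :
    ∃ (e : HeytingHom (GodelChain (n + 2)) M) (p : HeytingHom M (GodelChain (n + 2))),
      p.comp e = HeytingHom.id _ := by
  -- `Cₙ₊₂` lives in the lowest universe, its power `C` in that of `M`.
  let C := PUnit.{u + 1} → GodelChain (n + 2)
  let up : HeytingHom (GodelChain (n + 2)) C := constHom PUnit (GodelChain (n + 2))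
  have hup : Function.Injective up := Function.const_injective
  have hC : InISP C M := (hM C).mpr ⟨PUnit, HeytingHom.id C, Function.injective_id⟩
  obtain ⟨e, he⟩ := hC.exists_hom_ne (hup.ne coatom_ne_top)
  have hMn : InISP M (GodelChain (n + 2)) :=
    (hM M).mp (.of_injective (HeytingHom.id M) Function.injective_id)
  obtain ⟨p, hp⟩ := hMn.exists_hom_ne he
  refine ⟨e.comp up, p, eq_id_of_injective (injective_of_map_coatom_ne_top le_coatom ?_)⟩
  rw [← map_top (p.comp (e.comp up))]
  exact hp

end GodelChain

/-! ## Term functions -/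

-- The element `a` is the value of the term in `A` under the assignment `v`.
theorem IsTermFunction.exists_eq_apply {A : Type v} {M S : Type u} [HeytingAlgebra A]
    [HeytingAlgebra M] {σ : (S → M) → M} (hσ : IsTermFunction σ) (v : S → A) :
    ∃ a : A, ∀ x : HeytingHom A M, σ (x ∘ v) = x a := by
  induction hσ with
  | proj s => exact ⟨v s, fun _ => rfl⟩
  | bot => exact ⟨⊥, fun x => (map_bot x).symm⟩
  | top => exact ⟨⊤, fun x => (map_top x).symm⟩
  | inf _ _ hσ hτ =>
    obtain ⟨a, ha⟩ := hσ
    obtain ⟨b, hb⟩ := hτ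
    exact ⟨a ⊓ b, fun x => by simp only [map_inf, ha, hb]⟩
  | sup _ _ hσ hτ =>
    obtain ⟨a, ha⟩ := hσ
    obtain ⟨b, hb⟩ := hτ
    exact ⟨a ⊔ b, fun x => by simp only [map_sup, ha, hb]⟩
  | himp _ _ hσ hτ =>
    obtain ⟨a, ha⟩ := hσ
    obtain ⟨b, hb⟩ := hτ
    exact ⟨a ⇨ b, fun x => by simp only [map_himp, ha, hb]⟩

/-- The subalgebra with universe `r`. -/
abbrev IsHeytingSubuniverse.heytingAlgebra {A : Type u} [HeytingAlgebra A] {r : Set A}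
    (hr : IsHeytingSubuniverse r) : HeytingAlgebra r :=
  letI : Max r := ⟨fun a b => ⟨a ⊔ b, hr.sup_mem a a.2 b b.2⟩⟩
  letI : Min r := ⟨fun a b => ⟨a ⊓ b, hr.inf_mem a a.2 b b.2⟩⟩
  letI : HImp r := ⟨fun a b => ⟨a ⇨ b, hr.himp_mem a a.2 b b.2⟩⟩
  letI : Bot r := ⟨⟨⊥, hr.bot_mem⟩⟩
  letI : Top r := ⟨⟨⊤, hr.top_mem⟩⟩
  letI : Compl r := ⟨fun a => a ⇨ ⊥⟩
  Subtype.val_injective.heytingAlgebra Subtype.val Iff.rfl Iff.rfl (fun _ _ => rfl)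
    (fun _ _ => rfl) rfl rfl (fun a => himp_bot a.1) (fun _ _ => rfl)

theorem isHeytingSubuniverse_termFunctions (M S : Type u) [HeytingAlgebra M] :
    IsHeytingSubuniverse {σ : (S → M) → M | IsTermFunction σ} where
  bot_mem := .bot
  top_mem := .top
  inf_mem _ hσ _ hτ := hσ.inf hτ
  sup_mem _ hσ _ hτ := hσ.sup hτ
  himp_mem _ hσ _ hτ := hσ.himp hτ

/-- The algebra of `S`-ary term functions of `M`, a subalgebra of a power of `M`: the free algebra
of `ISP(M)` generated by `S`. -/
def TermFunction (M S : Type u) [HeytingAlgebra M] : Type u :=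
  {σ : (S → M) → M | IsTermFunction σ}

namespace TermFunction

variable {M S : Type u} [HeytingAlgebra M]

instance : HeytingAlgebra (TermFunction M S) :=
  (isHeytingSubuniverse_termFunctions M S).heytingAlgebra

/-- The generator of the free algebra `TermFunction M S` indexed by `s`. -/
def proj (s : S) : TermFunction M S := ⟨fun y => y s, .proj s⟩

variable (M S) in
/-- The inclusion of the term functions into the power of `M` formed by all functions. -/
def inclusion : HeytingHom (TermFunction M S) ((S → M) → M) where
  toFun := Subtype.val
  map_sup' _ _ := rfl
  map_inf' _ _ := rfl
  map_bot' := rfl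
  map_himp' _ _ := rfl

theorem inISP : InISP (TermFunction M S) M :=
  ⟨S → M, inclusion M S, Subtype.val_injective⟩

end TermFunction

/-! ## Restrictions of homomorphisms -/

/-- The restrictions along `v : S → B` of the homomorphisms `B → M`, as a subset of `M^S`. -/
def homRestrictions {B : Type v} [HeytingAlgebra B] (M : Type u) [HeytingAlgebra M] {S : Type u}
    (v : S → B) : Set (S → M) :=
  Set.range fun x : HeytingHom B M => x ∘ v

theorem TotalAlterEgo.isClosedSubstructure_homRestrictions {B : Type v} {M S : Type u}
    [HeytingAlgebra B] [HeytingAlgebra M] [TopologicalSpace M] [DiscreteTopology M] [Finite S]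
    (𝕄 : TotalAlterEgo M) (v : S → B) : 𝕄.IsClosedSubstructure S (homRestrictions M v) where
  isClosed := isClosed_discrete _
  op_mem k g w hw := by
    choose x hx using hw
    exact ⟨g.1.comp (HeytingHom.tuple x),
      funext fun s => congrArg g.1 (funext fun i => congrFun (hx i) s)⟩

theorem IsTermClosed.comp_mem_homRestrictions {A B : Type*} {M S : Type u} [HeytingAlgebra A]
    [HeytingAlgebra B] [HeytingAlgebra M] {ι : HeytingHom A B}
    (hι : Function.Injective ι) (hB : InISP B M) {v : S → A}
    (hX : IsTermClosed (homRestrictions M (ι ∘ v))) (h : HeytingHom A M) :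
    h ∘ v ∈ homRestrictions M (ι ∘ v) := by
  by_contra hy
  obtain ⟨σ, τ, hσ, hτ, heq, hne⟩ := hX _ hy
  obtain ⟨a, ha⟩ := hσ.exists_eq_apply v
  obtain ⟨b, hb⟩ := hτ.exists_eq_apply v
  have hab : a ≠ b := by
    rintro rfl
    exact hne ((ha h).trans (hb h).symm)
  obtain ⟨x, hx⟩ := hB.exists_hom_ne (hι.ne hab)
  exact hx ((ha (x.comp ι)).symm.trans ((heq _ ⟨x, rfl⟩).trans (hb (x.comp ι))))

/-! ## Full dualities with an injective alter ego -/

namespace TotalAlterEgo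

section

variable {M : Type u} [HeytingAlgebra M] {𝕄 : TotalAlterEgo M}

/-- Composition of morphisms. -/
def Hom.comp {X Y Z : 𝕄.Str} (ψ : Hom Y Z) (φ : Hom X Y) : Hom X Z where
  toFun := ψ.toFun ∘ φ.toFun
  continuous_toFun := ψ.continuous_toFun.comp φ.continuous_toFun
  map_op k g w := by simp only [Function.comp_apply, φ.map_op, ψ.map_op]
  map_rel k r w h := ψ.map_rel k r _ (φ.map_rel k r w h)

variable [TopologicalSpace M] (𝕄)

/-- The projection of a power of `𝕄` to one of its coordinates, as a morphism. -/
def powerProj {S : Type u} (s : S) : Hom (𝕄.power S) 𝕄.self where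
  toFun y := y s
  continuous_toFun := continuous_apply s
  map_op _ _ _ := rfl
  map_rel _ _ _ hw := hw s

/-- Restriction of homomorphisms along `v : S → A`, as a morphism `D(A) → 𝕄^S`. -/
def dualRestrict {A S : Type u} [HeytingAlgebra A] (v : S → A) : Hom (𝕄.D A) (𝕄.power S) where
  toFun := fun x : HeytingHom A M => x ∘ v
  continuous_toFun :=
    continuous_pi fun s => (continuous_apply (v s)).comp continuous_induced_dom
  map_op _ _ _ := rfl
  map_rel _ _ _ hw s := hw (v s)

theorem inTopQuasivariety_power (S : Type u) [Nonempty S] : InTopQuasivariety (𝕄.power S) :=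
  ⟨S, inferInstance, ⟨id, continuous_id, fun _ _ _ => rfl, fun _ _ _ hw => hw⟩,
    ⟨.id, fun _ _ _ hw => hw⟩, by simp only [Set.range_id, isClosed_univ]⟩

namespace IsClosedSubstructure

variable {𝕄} {S : Type u} {X : Set (S → M)} (hX : 𝕄.IsClosedSubstructure S X)

/-- The structure with universe `X` induced by the power `𝕄^S`. -/
def toStr : 𝕄.Str where
  carrier := X
  op k g w := ⟨fun s => g.1 (fun i => (w i).1 s), hX.op_mem k g _ fun i => (w i).2⟩
  rel _ r := {w | ∀ s, (fun i => (w i).1 s) ∈ r.1}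

/-- The inclusion of a substructure of `𝕄^S`, as a morphism. -/
def inclusion : Hom hX.toStr (𝕄.power S) where
  toFun := Subtype.val
  continuous_toFun := continuous_subtype_val
  map_op _ _ _ := rfl
  map_rel _ _ _ hw := hw

theorem isEmbedding_inclusion : hX.inclusion.IsEmbedding where
  isEmbedding_toFun := .subtypeVal
  reflects_rel _ _ _ hw := hw

theorem inTopQuasivariety [Nonempty S] : InTopQuasivariety hX.toStr :=
  ⟨S, inferInstance, hX.inclusion, hX.isEmbedding_inclusion,
    (Subtype.range_coe (s := X)).symm ▸ hX.isClosed⟩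

end IsClosedSubstructure

end

variable {M : Type u} [HeytingAlgebra M] [TopologicalSpace M] [DiscreteTopology M]
  {𝕄 : TotalAlterEgo M}

namespace E

/-- The contravariant functor `E` on morphisms: precomposition with `φ`. -/
def precomp {X Y : 𝕄.Str} (φ : Hom X Y) : HeytingHom (E Y) (E X) where
  toFun f := Hom.comp f φ
  map_sup' _ _ := rfl
  map_inf' _ _ := rfl
  map_bot' := rfl
  map_himp' _ _ := rfl

/-- The inclusion of `E(X)` into the power `M^X`. -/
def toMapHom (X : 𝕄.Str) : HeytingHom (E X) (X.carrier → M) where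
  toFun := toMap
  map_sup' _ _ := rfl
  map_inf' _ _ := rfl
  map_bot' := rfl
  map_himp' _ _ := rfl

theorem inISP (X : 𝕄.Str) : InISP (E X) M :=
  ⟨X.carrier, toMapHom X, toMap_injective⟩

/-- Evaluation at a point: the map `ε_X : X → DE(X)`. -/
def evalAt {X : 𝕄.Str} (x : X.carrier) : HeytingHom (E X) M :=
  (coordHom M x).comp (toMapHom X)

theorem exists_hom_of_not_separated {X : 𝕄.Str} {S : Type u} (q : X.carrier → S → M)
    (hterm : ∀ f : E X, ∃ σ, IsTermFunction σ ∧ ∀ x, f.toMap x = σ (q x)) {y : S → M}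
    (hy : ∀ σ τ, IsTermFunction σ → IsTermFunction τ → (∀ x, σ (q x) = τ (q x)) → σ y = τ y) :
    ∃ u : HeytingHom (E X) M,
      ∀ f σ, IsTermFunction σ → (∀ x, f.toMap x = σ (q x)) → u f = σ y := by
  choose t ht hft using hterm
  have ht_eq (f : E X) {σ : (S → M) → M} (hσ : IsTermFunction σ)
      (hfσ : ∀ x, f.toMap x = σ (q x)) : t f y = σ y :=
    hy _ _ (ht f) hσ fun x => (hft f x).symm.trans (hfσ x)
  let u : HeytingHom (E X) M :=
    { toFun := fun f => t f y
      map_sup' := fun f g =>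
        ht_eq (f ⊔ g) ((ht f).sup (ht g)) fun x => congrArg₂ _ (hft f x) (hft g x)
      map_inf' := fun f g =>
        ht_eq (f ⊓ g) ((ht f).inf (ht g)) fun x => congrArg₂ _ (hft f x) (hft g x)
      map_bot' := ht_eq ⊥ .bot fun _ => rfl
      map_himp' := fun f g =>
        ht_eq (f ⇨ g) ((ht f).himp (ht g)) fun x => congrArg₂ _ (hft f x) (hft g x) }
  exact ⟨u, fun f σ hσ hfσ => ht_eq f hσ hfσ⟩

end E

theorem YieldsDuality.isTermFunction (hdual : 𝕄.YieldsDuality) {S : Type u}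
    (β : Hom (𝕄.power S) 𝕄.self) : IsTermFunction β.toFun := by
  obtain ⟨σ, hσ⟩ := (hdual _ TermFunction.inISP).2 (β.comp (𝕄.dualRestrict TermFunction.proj))
  have hβ : σ.1 = β.toFun := funext fun z =>
    let evalz : HeytingHom (TermFunction M S) M := (coordHom M z).comp (TermFunction.inclusion M S)
    congrFun (congrArg E.toMap hσ) evalz
  exact hβ ▸ σ.2

-- Naturality of `ε` transfers the surjectivity of `ε_{D(B)}` to `X`.
theorem YieldsDuality.evalAt_surjective (hdual : 𝕄.YieldsDuality) {B : Type u} [HeytingAlgebra B]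
    (hB : InISP B M) {X : 𝕄.Str} (φ : Hom (𝕄.D B) X) (ψ : Hom X (𝕄.D B))
    (hφψ : ∀ x, φ.toFun (ψ.toFun x) = x) : Function.Surjective (E.evalAt (X := X)) := by
  intro u
  let v : HeytingHom B M := (u.comp (E.precomp ψ)).comp (𝕄.eval B)
  refine ⟨φ.toFun v, HeytingHom.ext fun f => ?_⟩
  obtain ⟨b, hb⟩ := (hdual B hB).2 (E.precomp φ f)
  calc E.evalAt (φ.toFun v) f = (E.precomp φ f).toMap v := rfl
    _ = v b := by rw [← hb]; rfl
    _ = u (E.precomp ψ (E.precomp φ f)) := by rw [← hb]; rfl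
    _ = u f := congrArg u (E.toMap_injective (funext fun x => congrArg f.toMap (hφψ x)))

theorem YieldsFullDuality.yieldsStrongDuality (hfull : 𝕄.YieldsFullDuality)
    (hinj : 𝕄.IsInjective) : 𝕄.YieldsStrongDuality := by
  refine ⟨hfull.1, fun S _ X hX y hyX => ?_⟩
  by_contra! hy
  have hterm (f : E hX.toStr) :
      ∃ σ, IsTermFunction σ ∧ ∀ x, f.toMap x = σ (hX.inclusion.toFun x) := by
    obtain ⟨β, hβ⟩ := hinj _ _ hX.inTopQuasivariety (𝕄.inTopQuasivariety_power S) hX.inclusion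
      hX.isEmbedding_inclusion f
    exact ⟨β.toFun, hfull.1.isTermFunction β, fun x => (hβ x).symm⟩
  obtain ⟨u, hu⟩ := E.exists_hom_of_not_separated hX.inclusion.toFun hterm
    fun σ τ hσ hτ hστ => hy σ τ hσ hτ fun x hx => hστ ⟨x, hx⟩
  obtain ⟨φ, ψ, -, hφψ⟩ := hfull.2 _ hX.inTopQuasivariety
  obtain ⟨x, rfl⟩ := hfull.1.evalAt_surjective (E.inISP hX.toStr) φ ψ hφψ u
  have hxy : x.1 = y := funext fun s =>
    hu ((𝕄.powerProj s).comp hX.inclusion) _ (.proj s) fun _ => rfl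
  exact hyX (hxy ▸ x.2)

end TotalAlterEgo

theorem corollary6p2_general (n : ℕ) [NeZero n] (hn : 4 ≤ n)
    (M : Type u) [HeytingAlgebra M] [TopologicalSpace M] [DiscreteTopology M]
    (hM : ∀ (A : Type u) [HeytingAlgebra A], InISP A M ↔ InGodelVariety n A)
    (𝕄 : TotalAlterEgo M) :
    ∃ S : Type u, Nonempty S ∧ Finite S ∧
      ∃ X : Set (S → M), 𝕄.IsClosedSubstructure S X ∧ ¬ IsTermClosed X := by
  obtain ⟨m, rfl⟩ := Nat.exists_eq_add_of_le' hn
  obtain ⟨e, p, hpe⟩ := GodelChain.exists_retraction hM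
  have he : Function.Injective e := Function.LeftInverse.injective (DFunLike.congr_fun hpe)
  obtain ⟨ι, κ, hι, hικ⟩ := GodelChain.exists_embedding_comp_ne m
  let v : ULift.{u} (GodelChain (m + 3)) → GodelChain (m + 3) := ULift.down
  refine ⟨_, inferInstance, inferInstance, homRestrictions M (ι ∘ v),
    𝕄.isClosedSubstructure_homRestrictions _, fun hX => ?_⟩
  obtain ⟨x, hx⟩ := hX.comp_mem_homRestrictions hι (.of_injective e he) (e.comp κ)
  refine hικ (p.comp x) (HeytingHom.ext fun a => ?_)
  calc p (x (ι a)) = p (e (κ a)) := congrArg p (congrFun hx ⟨a⟩)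
    _ = κ a := DFunLike.congr_fun hpe (κ a)

/-- For `n ≥ 4` the variety `𝒢ₙ` admits no total single-sorted strong duality: whatever finite
algebra `M` with `ISP(M) = 𝒢ₙ` is chosen, no total alter ego of `M` yields a strong duality, neither
in the sense of term-closed closed substructures nor in the equivalent sense of a full duality with
an injective alter ego. -/
theorem corollary6p2 (n : ℕ) [NeZero n] (hn : 4 ≤ n)
    (M : Type u) [HeytingAlgebra M] [Finite M] [TopologicalSpace M] [DiscreteTopology M]
    (hM : ∀ (A : Type u) [HeytingAlgebra A], InISP A M ↔ InGodelVariety n A) :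
    (¬ ∃ 𝕄 : TotalAlterEgo M, 𝕄.YieldsStrongDuality) ∧
      ¬ ∃ 𝕄 : TotalAlterEgo M, 𝕄.YieldsFullDuality ∧ 𝕄.IsInjective := by
  have no_strong : ¬ ∃ 𝕄 : TotalAlterEgo M, 𝕄.YieldsStrongDuality := fun ⟨𝕄, h𝕄⟩ =>
    let ⟨S, hS, _, X, hX, hterm⟩ := corollary6p2_general n hn M hM 𝕄
    hterm (h𝕄.2 S hS X hX)
  exact ⟨no_strong, fun ⟨𝕄, hfull, hinj⟩ => no_strong ⟨𝕄, hfull.yieldsStrongDuality hinj⟩⟩
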